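/- **Definitions.** A *strong projection algebra* is a non-empty set $P$ with binary operations $\times,\star$ such that for all $e,f,g\in P$: - $e\times e=e$, $(e\times f)\times e=e\times f$, $e\times(f\times g)=(e\times f)\times(f\times g)$, $(e\times f)\times g=(e\times f)\times(e\times g)$; - $e\star e=e$, $f\star e=e\star(f\star e)$, $(g\star f)\star e=(g\star f)\star(f\star e)$, $g\star(f\star e)=(g\star e)\star(f\star e)$; - $(e\star(f\times g))\star g=(e\star f)\star g$, $g\times((g\star f)\times e)=g\times(f\times e)$, $(e\times f)\star e=e\times f$, $f\times(e\star f)=e\star f$; - $e\times(((e\times f)\times g)\star f)=(e\times f)\times g$, $(f\times(g\star(f\star e)))\star e=g\star(f\star e)$. It is partially ordered by $e\le f\iff e=f\times e$. For $p\in P$ the set $p^{\downarrow}=\{x\in P\mid x\le p\}$ is a subalgebra. An isomorphism of projection algebras is a bijection that preserves $\times$ and $\star$. A *DRC-restriction semigroup* is a semigroup $S$ with unary operations $^+,{}^*$ such that for all $x,y\in S$: $x^+x=x$, $xx^*=x$; $(xy)^+=(xy^+)^+$, $(xy)^*=(x^*y)^*$; $(xy)^+=x^+(xy)^+x^+$,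 $(xy)^*=y^*(xy)^*y^*$; $x^{++}=x^+$, $x^{**}=x^*$; $x^{+*}=x^+$, $x^{*+}=x^*$; $x(yx)^*=(yx^+)^*x$, $(xy)^+x=x(x^*y)^+$. Its set of projections is $P(S)=\{x^+\mid x\in S\}$, which is a strong projection algebra under $e\times f=(ef)^+$, $e\star f=(ef)^*$ (the projection algebra of $S$). A *(2,1,1)-congruence* on $S$ is an equivalence relation compatible with $\cdot,{}^+,{}^*$; it is *projection-separating* if any two related projections are equal. $S$ is *projection-fundamental* if the identity relation is the only projection-separating (2,1,1)-congruence on $S$. A *(2,1,1)-subalgebra* is a subset closed under $\cdot,{}^+,{}^*$; it is *full* if it contains all projections. Isomorphisms are bijections that preserve $\cdot,{}^+,{}^*$. For a strong projection algebra $P$, let $M(P)$ be the set of all projection algebra isomorphisms $\alpha\colon p^{\downarrow}\to q^{\downarrow}$ with $p,q\in P$. Maps are written on the right and composed from left to right. The algebra $\mathbf S(M(P))=(M(P),\bullet,{}^+,{}^*)$ is defined as follows: for $\alpha\colon p^{\downarrow}\to q^{\downarrow}$ and $\beta\colon s^{\downarrow}\to t^{\downarrow}$ in $M(P)$, $$\alpha\bullet\beta=\alpha|_{((q\times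 s)\alpha^{-1})^{\downarrow}}\circ\gamma_{q\times s,\,q\star s}\circ\beta|_{(q\star s)^{\downarrow}},\qquad \alpha^+=\mathrm{id}_{p^{\downarrow}},\qquad \alpha^*=\mathrm{id}_{q^{\downarrow}},$$ where $\gamma_{u,v}\colon u^{\downarrow}\to v^{\downarrow}$, $x\mapsto x\star v$ (an isomorphism when $u\times v=u$ and $u\star v=v$, as is the case for $u=q\times s$, $v=q\star s$). **Theorem 8.9.** Let $P$ be a strong projection algebra, and let $S$ be a DRC-restriction semigroup whose projection algebra is isomorphic to $P$. Then $S$ is projection-fundamental if and only if $S$ is isomorphic to some full (2,1,1)-subalgebra of $\mathbf S(M(P))$. In particular, $\mathbf S(M(P))$ is a projection-fundamental DRC-restriction semigroup. -/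

import Mathlib

/-! ### Projection algebras -/

/-- The signature of a projection algebra: two binary operations. -/
class ProjOps (P : Type*) where
  /-- the operation `×` -/
  times : P → P → P
  /-- the operation `⋆` -/
  star : P → P → P

infixl:70 " ×ₚ " => ProjOps.times
infixl:70 " ⋆ₚ " => ProjOps.star

/-- Strong (two-sided) projection algebras: `(P, ×)` is a left projection algebra (L1-L4),
`(P, ⋆)` is a right projection algebra (R1-R4), the two are linked by (P3), (P4), and the strong
axioms (SP1), (SP2) hold. -/
class StrongProjectionAlgebra (P : Type*) extends ProjOps P where
  nonempty : Nonempty P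
  L1 : ∀ e : P, e ×ₚ e = e
  L2 : ∀ e f : P, (e ×ₚ f) ×ₚ e = e ×ₚ f
  L3 : ∀ e f g : P, e ×ₚ (f ×ₚ g) = (e ×ₚ f) ×ₚ (f ×ₚ g)
  L4 : ∀ e f g : P, (e ×ₚ f) ×ₚ g = (e ×ₚ f) ×ₚ (e ×ₚ g)
  R1 : ∀ e : P, e ⋆ₚ e = e
  R2 : ∀ e f : P, f ⋆ₚ e = e ⋆ₚ (f ⋆ₚ e)
  R3 : ∀ e f g : P, (g ⋆ₚ f) ⋆ₚ e = (g ⋆ₚ f) ⋆ₚ (f ⋆ₚ e)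
  R4 : ∀ e f g : P, g ⋆ₚ (f ⋆ₚ e) = (g ⋆ₚ e) ⋆ₚ (f ⋆ₚ e)
  P3l : ∀ e f g : P, (e ⋆ₚ (f ×ₚ g)) ⋆ₚ g = (e ⋆ₚ f) ⋆ₚ g
  P3r : ∀ e f g : P, g ×ₚ ((g ⋆ₚ f) ×ₚ e) = g ×ₚ (f ×ₚ e)
  P4l : ∀ e f : P, (e ×ₚ f) ⋆ₚ e = e ×ₚ f
  P4r : ∀ e f : P, f ×ₚ (e ⋆ₚ f) = e ⋆ₚ f
  SP1 : ∀ e f g : P, e ×ₚ (((e ×ₚ f) ×ₚ g) ⋆ₚ f) = (e ×ₚ f) ×ₚ g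
  SP2 : ∀ e f g : P, (f ×ₚ (g ⋆ₚ (f ⋆ₚ e))) ⋆ₚ e = g ⋆ₚ (f ⋆ₚ e)

/-- The natural order of a projection algebra: `e ≤ f` iff `e = f × e`. -/
def ProjLE {P : Type*} [ProjOps P] (e f : P) : Prop := e = f ×ₚ e

/-- Isomorphisms of projection algebras: bijections preserving both operations. -/
structure ProjIso (P Q : Type*) [ProjOps P] [ProjOps Q] extends P ≃ Q where
  map_times : ∀ x y : P, toFun (x ×ₚ y) = toFun x ×ₚ toFun y
  map_star : ∀ x y : P, toFun (x ⋆ₚ y) = toFun x ⋆ₚ toFun y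

namespace StrongProjectionAlgebra

variable {P : Type*} [StrongProjectionAlgebra P]

theorem projLE_trans {e f g : P} (h : ProjLE e f) (k : ProjLE f g) : ProjLE e g := by
  unfold ProjLE at *
  have h1 := L3 g f e
  rw [← h, ← k, ← h] at h1
  exact h1.symm

theorem times_le (e f : P) : ProjLE (e ×ₚ f) e := by
  have h := L4 e e f
  rw [L1] at h
  exact h

theorem star_le (e f : P) : ProjLE (e ⋆ₚ f) f := (P4r e f).symm

theorem times_eq_of_le {e f : P} (h : ProjLE e f) : e ×ₚ f = e := by
  have h1 := L2 f e
  unfold ProjLE at h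
  rw [← h] at h1
  exact h1

theorem star_eq_of_le {e f : P} (h : ProjLE e f) : e ⋆ₚ f = e := by
  have h1 := P4l f e
  unfold ProjLE at h
  rw [← h] at h1
  exact h1

theorem star_eq_of_ge {e f : P} (h : ProjLE e f) : f ⋆ₚ e = e := by
  have h1 := R2 f e
  rw [star_eq_of_le h] at h1
  exact h1.symm

theorem times_star_right (e f : P) : (e ×ₚ f) ⋆ₚ f = e ⋆ₚ f := by
  have h := P3l e e f
  rw [R1, star_eq_of_ge (times_le e f)] at h
  exact h

theorem times_star_left (e f : P) : e ×ₚ (e ⋆ₚ f) = e ×ₚ f := by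
  have h := P3r f f e
  rw [L1, times_eq_of_le (star_le e f)] at h
  exact h

theorem times_times_star (p q : P) : (p ×ₚ q) ×ₚ (p ⋆ₚ q) = p ×ₚ q := by
  rw [L4, times_star_left, L1]

theorem times_star_star (p q : P) : (p ×ₚ q) ⋆ₚ (p ⋆ₚ q) = p ⋆ₚ q := by
  rw [R4, times_star_right, R1]

theorem times_star_of_le {e f g : P} (h : ProjLE g (e ×ₚ f)) : e ×ₚ (g ⋆ₚ f) = g := by
  have h1 := SP1 e f g
  unfold ProjLE at h
  rw [← h] at h1
  exact h1

theorem star_times_of_le {e f g : P} (h : ProjLE g (f ⋆ₚ e)) : (f ×ₚ g) ⋆ₚ e = g := by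
  have h1 := SP2 e f g
  rw [star_eq_of_le h] at h1
  exact h1

theorem times_times_of_le {x p : P} (h : ProjLE x p) (t : P) : x ×ₚ (p ×ₚ t) = x ×ₚ t := by
  have h1 := L4 p x t
  unfold ProjLE at h
  rw [← h] at h1
  exact h1.symm

theorem star_times (t s p : P) : t ⋆ₚ (s ×ₚ p) = s ×ₚ ((t ⋆ₚ s) ⋆ₚ p) := by
  rw [← P3l, times_star_of_le (star_le _ _)]

theorem times_of_star (p s t : P) : (p ⋆ₚ s) ×ₚ t = (p ×ₚ (s ×ₚ t)) ⋆ₚ s := by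
  rw [← P3r, star_times_of_le (times_le _ _)]

end StrongProjectionAlgebra

open StrongProjectionAlgebra in
/-- The principal order ideal `p^↓ = {x ∈ P ∣ x ≤ p}`. -/
def ProjDown {P : Type*} [StrongProjectionAlgebra P] (p : P) : Type _ := {x : P // ProjLE x p}

open StrongProjectionAlgebra in
/-- `p^↓` is a subalgebra of `P`, with the operations of `P`. -/
instance {P : Type*} [StrongProjectionAlgebra P] (p : P) : ProjOps (ProjDown p) where
  times x y := ⟨x.1 ×ₚ y.1, projLE_trans (times_le _ _) x.2⟩
  star x y := ⟨x.1 ⋆ₚ y.1, projLE_trans (star_le _ _) y.2⟩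

/-! ### The set `M(P)` of isomorphisms between principal ideals -/

namespace ProjIso

open StrongProjectionAlgebra

/-- The identity isomorphism. -/
def refl (P : Type*) [ProjOps P] : ProjIso P P where
  toEquiv := Equiv.refl P
  map_times _ _ := rfl
  map_star _ _ := rfl

/-- Composition, from left to right. -/
def trans {P Q R : Type*} [ProjOps P] [ProjOps Q] [ProjOps R]
    (α : ProjIso P Q) (β : ProjIso Q R) : ProjIso P R where
  toEquiv := α.toEquiv.trans β.toEquiv
  map_times x y := (congrArg β.toFun (α.map_times x y)).trans (β.map_times _ _)
  map_star x y := (congrArg β.toFun (α.map_star x y)).trans (β.map_star _ _)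

/-- The inverse isomorphism. -/
def symm {P Q : Type*} [ProjOps P] [ProjOps Q] (α : ProjIso P Q) : ProjIso Q P where
  toEquiv := α.toEquiv.symm
  map_times x y := by
    apply α.toEquiv.injective
    have h := α.map_times (α.toEquiv.symm x) (α.toEquiv.symm y)
    simpa using h.symm
  map_star x y := by
    apply α.toEquiv.injective
    have h := α.map_star (α.toEquiv.symm x) (α.toEquiv.symm y)
    simpa using h.symm

variable {P : Type*} [StrongProjectionAlgebra P]

theorem map_le {p q : P} (α : ProjIso (ProjDown p) (ProjDown q)) {x y : ProjDown p}
    (h : ProjLE x.1 y.1) : ProjLE (α.toFun x).1 (α.toFun y).1 := by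
  have h1 : x = y ×ₚ x := Subtype.ext h
  have h2 := α.map_times y x
  rw [← h1] at h2
  exact congrArg Subtype.val h2

/-- For `α : p^↓ → q^↓` and `e ∈ p^↓`, the restriction `α|_{e^↓} : e^↓ → (eα)^↓`. -/
def restrict {p q : P} (α : ProjIso (ProjDown p) (ProjDown q)) (e : ProjDown p) :
    ProjIso (ProjDown e.1) (ProjDown (α.toFun e).1) where
  toFun x := ⟨(α.toFun ⟨x.1, projLE_trans x.2 e.2⟩).1, α.map_le x.2⟩
  invFun y := ⟨(α.symm.toFun ⟨y.1, projLE_trans y.2 (α.toFun e).2⟩).1, by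
    have h := α.symm.map_le (x := ⟨y.1, projLE_trans y.2 (α.toFun e).2⟩) (y := α.toFun e) y.2
    have h2 : α.symm.toFun (α.toFun e) = e := α.left_inv e
    rwa [h2] at h⟩
  left_inv x := by
    have h := congrArg Subtype.val (α.left_inv ⟨x.1, projLE_trans x.2 e.2⟩)
    exact Subtype.ext h
  right_inv y := by
    have h := congrArg Subtype.val (α.right_inv ⟨y.1, projLE_trans y.2 (α.toFun e).2⟩)
    exact Subtype.ext h
  map_times x y := by
    have h := congrArg Subtype.val
      (α.map_times ⟨x.1, projLE_trans x.2 e.2⟩ ⟨y.1, projLE_trans y.2 e.2⟩)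
    exact Subtype.ext h
  map_star x y := by
    have h := congrArg Subtype.val
      (α.map_star ⟨x.1, projLE_trans x.2 e.2⟩ ⟨y.1, projLE_trans y.2 e.2⟩)
    exact Subtype.ext h

/-- For `α : p^↓ → q^↓` and `f ∈ q^↓`, the restriction of `α` to `(fα⁻¹)^↓`, which maps
`(fα⁻¹)^↓` onto `f^↓`. -/
def corestrict {p q : P} (α : ProjIso (ProjDown p) (ProjDown q)) (f : ProjDown q) :
    ProjIso (ProjDown (α.symm.toFun f).1) (ProjDown f.1) :=
  (α.symm.restrict f).symm

/-- If `p × q = p` and `p ⋆ q = q`, then `γ_{p,q} : p^↓ → q^↓`, `x ↦ x ⋆ q`, is an isomorphism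
with inverse `y ↦ p × y`. -/
def gamma (p q : P) (h : p ×ₚ q = p) (k : p ⋆ₚ q = q) : ProjIso (ProjDown p) (ProjDown q) where
  toFun x := ⟨x.1 ⋆ₚ q, star_le _ _⟩
  invFun y := ⟨p ×ₚ y.1, times_le _ _⟩
  left_inv x := Subtype.ext (times_star_of_le (by rw [h]; exact x.2))
  right_inv y := Subtype.ext (star_times_of_le (by rw [k]; exact y.2))
  map_times x y := Subtype.ext (by
    change (x.1 ×ₚ y.1) ⋆ₚ q = (x.1 ⋆ₚ q) ×ₚ (y.1 ⋆ₚ q)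
    have hy : p ×ₚ (y.1 ⋆ₚ q) = y.1 := times_star_of_le (by rw [h]; exact y.2)
    rw [times_of_star, P4r, ← times_times_of_le x.2 (y.1 ⋆ₚ q), hy])
  map_star x y := Subtype.ext (by
    change (x.1 ⋆ₚ y.1) ⋆ₚ q = (x.1 ⋆ₚ q) ⋆ₚ (y.1 ⋆ₚ q)
    have hy : p ×ₚ (y.1 ⋆ₚ q) = y.1 := times_star_of_le (by rw [h]; exact y.2)
    have h1 : x.1 ⋆ₚ y.1 = p ×ₚ (x.1 ⋆ₚ (y.1 ⋆ₚ q)) := by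
      conv_lhs => rw [← hy, star_times, star_eq_of_le x.2]
    rw [h1, ← R4]
    exact star_times_of_le (by rw [k]; exact projLE_trans (star_le _ _) (star_le _ _)))

end ProjIso

/-- `M(P)`: all projection algebra isomorphisms `p^↓ → q^↓`, for `p, q ∈ P`.  (As `p` is the
greatest element of `p^↓`, the set `p^↓` determines `p`, so that the union over `p` and `q` is
disjoint and may be taken as this type of triples.) -/
structure IdealIso (P : Type*) [StrongProjectionAlgebra P] where
  /-- the `p` for which the domain is `p^↓` -/
  dom : P
  /-- the `q` for which the range is `q^↓` -/
  cod : P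
  /-- the isomorphism `p^↓ → q^↓` -/
  iso : ProjIso (ProjDown dom) (ProjDown cod)

/-! ### DRC-restriction semigroups -/

/-- Algebras of type (2,1,1): a multiplication and two unary operations `⁺` and `∗`. -/
class BiUnary (S : Type*) extends Mul S where
  /-- the unary operation `x ↦ x⁺` -/
  plus : S → S
  /-- the unary operation `x ↦ x^∗` -/
  ast : S → S

open BiUnary in
/-- DRC-restriction semigroups: associativity, the DRC conditions (i)-(v), (i)'-(v)' and the
DRC-ample conditions (vi), (vi)'. -/
class IsDRCRestriction (S : Type*) [BiUnary S] : Prop where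
  mul_assoc : ∀ x y z : S, (x * y) * z = x * (y * z)
  plus_mul : ∀ x : S, plus x * x = x
  mul_ast : ∀ x : S, x * ast x = x
  plus_mul_plus : ∀ x y : S, plus (x * y) = plus (x * plus y)
  ast_ast_mul : ∀ x y : S, ast (x * y) = ast (ast x * y)
  plus_sandwich : ∀ x y : S, plus (x * y) = plus x * plus (x * y) * plus x
  ast_sandwich : ∀ x y : S, ast (x * y) = ast y * ast (x * y) * ast y
  plus_plus : ∀ x : S, plus (plus x) = plus x
  ast_ast : ∀ x : S, ast (ast x) = ast x
  ast_plus : ∀ x : S, ast (plus x) = plus x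
  plus_ast : ∀ x : S, plus (ast x) = ast x
  ample_ast : ∀ x y : S, x * ast (y * x) = ast (y * plus x) * x
  ample_plus : ∀ x y : S, plus (x * y) * x = x * plus (ast x * y)

/-- The set of projections `P(S) = {x⁺ ∣ x ∈ S}`. -/
def projections (S : Type*) [BiUnary S] : Set S := Set.range BiUnary.plus

/-- The projection algebra of `S`: `e × f = (ef)⁺` and `e ⋆ f = (ef)^∗` on `P(S)`. -/
instance {S : Type*} [BiUnary S] [IsDRCRestriction S] : ProjOps (projections S) where
  times e f := ⟨BiUnary.plus (e.1 * f.1), _, rfl⟩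
  star e f := ⟨BiUnary.ast (e.1 * f.1), _, IsDRCRestriction.plus_ast _⟩

/-- (2,1,1)-congruences: equivalences compatible with the three operations. -/
structure IsBiUnaryCongruence {S : Type*} [BiUnary S] (σ : Setoid S) : Prop where
  mul_right : ∀ a b c : S, σ a b → σ (a * c) (b * c)
  mul_left : ∀ a b c : S, σ a b → σ (c * a) (c * b)
  plus : ∀ a b : S, σ a b → σ (BiUnary.plus a) (BiUnary.plus b)
  ast : ∀ a b : S, σ a b → σ (BiUnary.ast a) (BiUnary.ast b)

/-- A relation is projection-separating if related projections are equal. -/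
def IsProjectionSeparating {S : Type*} [BiUnary S] (σ : Setoid S) : Prop :=
  ∀ p ∈ projections S, ∀ q ∈ projections S, σ p q → p = q

/-- `S` is projection-fundamental if the identity relation is its only projection-separating
(2,1,1)-congruence. -/
def IsProjectionFundamental (S : Type*) [BiUnary S] : Prop :=
  ∀ σ : Setoid S, IsBiUnaryCongruence σ → IsProjectionSeparating σ → ∀ a b : S, σ a b → a = b

/-- Isomorphisms of (2,1,1)-algebras. -/
structure BiUnaryIso (S T : Type*) [BiUnary S] [BiUnary T] extends S ≃ T where
  map_mul : ∀ x y : S, toFun (x * y) = toFun x * toFun y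
  map_plus : ∀ x : S, toFun (BiUnary.plus x) = BiUnary.plus (toFun x)
  map_ast : ∀ x : S, toFun (BiUnary.ast x) = BiUnary.ast (toFun x)

/-- (2,1,1)-subalgebras: subsets closed under the three operations. -/
structure BiUnarySubalgebra (S : Type*) [BiUnary S] where
  /-- the underlying subset -/
  carrier : Set S
  mul_mem : ∀ {x y : S}, x ∈ carrier → y ∈ carrier → x * y ∈ carrier
  plus_mem : ∀ {x : S}, x ∈ carrier → BiUnary.plus x ∈ carrier
  ast_mem : ∀ {x : S}, x ∈ carrier → BiUnary.ast x ∈ carrier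

/-- A (2,1,1)-subalgebra with the operations of the ambient algebra. -/
instance {S : Type*} [BiUnary S] (T : BiUnarySubalgebra S) : BiUnary T.carrier where
  mul x y := ⟨x.1 * y.1, T.mul_mem x.2 y.2⟩
  plus x := ⟨BiUnary.plus x.1, T.plus_mem x.2⟩
  ast x := ⟨BiUnary.ast x.1, T.ast_mem x.2⟩

/-- A (2,1,1)-subalgebra is full if it contains all projections. -/
def BiUnarySubalgebra.IsFull {S : Type*} [BiUnary S] (T : BiUnarySubalgebra S) : Prop :=
  projections S ⊆ T.carrier

/-! ### The algebra `S(M(P))` -/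

open StrongProjectionAlgebra in
/-- The (2,1,1)-algebra `S(M(P))` on `M(P)`.  For `α : p^↓ → q^↓` and `β : s^↓ → t^↓`, the product
`α • β` is the composite, from left to right, of `α` restricted to `((q × s)α⁻¹)^↓`, of
`γ_{q × s, q ⋆ s}`, and of `β` restricted to `(q ⋆ s)^↓`; further `α⁺` is the identity map
of `p^↓` and `α^∗` is the identity map of `q^↓`. -/
instance {P : Type*} [StrongProjectionAlgebra P] : BiUnary (IdealIso P) where
  mul α β :=
    { dom := (α.iso.symm.toFun ⟨α.cod ×ₚ β.dom, times_le _ _⟩).1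
      cod := (β.iso.toFun ⟨α.cod ⋆ₚ β.dom, star_le _ _⟩).1
      iso := ((α.iso.corestrict ⟨α.cod ×ₚ β.dom, times_le _ _⟩).trans
        (ProjIso.gamma (α.cod ×ₚ β.dom) (α.cod ⋆ₚ β.dom)
          (times_times_star _ _) (times_star_star _ _))).trans
        (β.iso.restrict ⟨α.cod ⋆ₚ β.dom, star_le _ _⟩) }
  plus α := ⟨α.dom, α.dom, ProjIso.refl _⟩
  ast α := ⟨α.cod, α.cod, ProjIso.refl _⟩

/-! An isomorphism `α : p^↓ → q^↓` is encoded by two total maps of `P`: `e ↦ (e ⋆ p)α` and `e ↦ (q ×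
e)α⁻¹`. The pair determines `α` (`ext_of_acts`), and `•` becomes composition of the first maps and
reversed composition of the second (`rightAct_mul`, `leftAct_mul`). The DRC-restriction laws of
`S(M(P))` thus reduce to identities between maps.

An abstract `S` acts on its projections in the same way, by `e ↦ (ex)^∗` and `e ↦ (xe)⁺`. The ample
laws make these mutually inverse between `(x⁺)^↓` and `(x^∗)^↓`, so `toIdealIso` is a homomorphism
into `S(M(P))` with full image. Its kernel separates projections, hence is trivial when `S` is
projection-fundamental.

Conversely, let `a` and `b` be related by a projection-separating congruence on a full subalgebra.
Multiplying by the projection of each `e` and taking `^∗` gives `(ea)^∗ = (eb)^∗`, so `a` and `b`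
are the same map. -/

/-! ### Further identities in strong projection algebras -/

namespace StrongProjectionAlgebra

variable {P : Type*} [StrongProjectionAlgebra P]

theorem projLE_refl (e : P) : ProjLE e e := (L1 e).symm

theorem projLE_antisymm {e f : P} (h : ProjLE e f) (k : ProjLE f e) : e = f :=
  (times_eq_of_le h).symm.trans k.symm

theorem star_star_of_le {u p : P} (h : ProjLE u p) (e : P) : (e ⋆ₚ p) ⋆ₚ u = e ⋆ₚ u := by
  have h1 := R4 p u e
  rw [star_eq_of_le h] at h1
  exact h1.symm

/-- Cutting down to `q × s` and applying `γ` has the same effect on `q^↓` as `⋆ s` alone; this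
absorbs the middle factor of `•`. -/
theorem times_star_star_of_le {x q : P} (h : ProjLE x q) (s : P) :
    (x ⋆ₚ (q ×ₚ s)) ⋆ₚ (q ⋆ₚ s) = x ⋆ₚ s := by
  have h1 := R3 s q x
  rw [star_eq_of_le h] at h1
  rw [R4, P3l, star_eq_of_le h, ← R4, ← h1]

theorem times_times_star_of_le {y s : P} (h : ProjLE y s) (q : P) :
    (q ×ₚ s) ×ₚ ((q ⋆ₚ s) ×ₚ y) = q ×ₚ y := by
  have h1 := L3 q s y
  unfold ProjLE at h
  rw [← h] at h1
  rw [L4, P3r, ← h, ← L4, ← h1]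

end StrongProjectionAlgebra

open StrongProjectionAlgebra

theorem ProjIso.ext_toFun {P Q : Type*} [ProjOps P] [ProjOps Q] {α β : ProjIso P Q}
    (h : ∀ x, α.toFun x = β.toFun x) : α = β := by
  obtain ⟨a, _, _⟩ := α
  obtain ⟨b, _, _⟩ := β
  obtain rfl : a = b := Equiv.ext h
  rfl

/-! ### Elements of `M(P)` as pairs of maps on `P` -/

namespace IdealIso

section Actions

variable {P : Type*} [StrongProjectionAlgebra P]

/-- The extension `e ↦ (e ⋆ p)α` of `α : p^↓ → q^↓` to the whole of `P`. -/
def rightAct (α : IdealIso P) (e : P) : P := (α.iso.toFun ⟨e ⋆ₚ α.dom, star_le _ _⟩).1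

/-- The extension `e ↦ (q × e)α⁻¹` of `α⁻¹ : q^↓ → p^↓` to the whole of `P`. -/
def leftAct (α : IdealIso P) (e : P) : P := (α.iso.symm.toFun ⟨α.cod ×ₚ e, times_le _ _⟩).1

theorem rightAct_le (α : IdealIso P) (e : P) : ProjLE (α.rightAct e) α.cod :=
  (α.iso.toFun _).2

theorem leftAct_le (α : IdealIso P) (e : P) : ProjLE (α.leftAct e) α.dom :=
  (α.iso.symm.toFun _).2

theorem rightAct_of_le (α : IdealIso P) {e : P} (h : ProjLE e α.dom) :
    α.rightAct e = (α.iso.toFun ⟨e, h⟩).1 :=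
  congrArg (fun x => (α.iso.toFun x).1) (Subtype.ext (star_eq_of_le h))

theorem leftAct_of_le (α : IdealIso P) {e : P} (h : ProjLE e α.cod) :
    α.leftAct e = (α.iso.symm.toFun ⟨e, h⟩).1 :=
  congrArg (fun x => (α.iso.symm.toFun x).1) (Subtype.ext h.symm)

theorem rightAct_leftAct (α : IdealIso P) {e : P} (h : ProjLE e α.cod) :
    α.rightAct (α.leftAct e) = e := by
  rw [rightAct_of_le α (leftAct_le α e)]
  have h1 : (⟨α.leftAct e, leftAct_le α e⟩ : ProjDown α.dom) = α.iso.symm.toFun ⟨e, h⟩ :=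
    Subtype.ext (leftAct_of_le α h)
  rw [h1]
  exact congrArg Subtype.val (α.iso.right_inv ⟨e, h⟩)

theorem leftAct_rightAct (α : IdealIso P) {e : P} (h : ProjLE e α.dom) :
    α.leftAct (α.rightAct e) = e := by
  rw [leftAct_of_le α (rightAct_le α e)]
  have h1 : (⟨α.rightAct e, rightAct_le α e⟩ : ProjDown α.cod) = α.iso.toFun ⟨e, h⟩ :=
    Subtype.ext (rightAct_of_le α h)
  rw [h1]
  exact congrArg Subtype.val (α.iso.left_inv ⟨e, h⟩)

theorem ext_of_dom_cod {α β : IdealIso P} (hd : α.dom = β.dom) (hc : α.cod = β.cod)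
    (h : ∀ e, ProjLE e α.dom → α.rightAct e = β.rightAct e) : α = β := by
  obtain ⟨p, q, a⟩ := α
  obtain ⟨p', q', b⟩ := β
  obtain rfl : p = p' := hd
  obtain rfl : q = q' := hc
  obtain rfl : a = b := ProjIso.ext_toFun fun x => Subtype.ext <|
    (rightAct_of_le ⟨p, q, a⟩ x.2).symm.trans
      ((h x.1 x.2).trans (rightAct_of_le ⟨p, q, b⟩ x.2))
  rfl

/-- The domain top is a value of the left action and an upper bound of all its values, so equal left
actions force equal domains; dually for ranges. -/
theorem ext_of_acts {α β : IdealIso P} (hr : ∀ e, α.rightAct e = β.rightAct e)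
    (hl : ∀ e, α.leftAct e = β.leftAct e) : α = β := by
  refine ext_of_dom_cod (projLE_antisymm ?_ ?_) (projLE_antisymm ?_ ?_) fun e _ => hr e
  · rw [← leftAct_rightAct α (projLE_refl _), hl]
    exact leftAct_le _ _
  · rw [← leftAct_rightAct β (projLE_refl _), ← hl]
    exact leftAct_le _ _
  · rw [← rightAct_leftAct α (projLE_refl _), hr]
    exact rightAct_le _ _
  · rw [← rightAct_leftAct β (projLE_refl _), ← hr]
    exact rightAct_le _ _

theorem rightAct_star_dom (α : IdealIso P) (e : P) : α.rightAct (e ⋆ₚ α.dom) = α.rightAct e :=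
  rightAct_of_le α (star_le _ _)

theorem leftAct_cod_times (α : IdealIso P) (e : P) : α.leftAct (α.cod ×ₚ e) = α.leftAct e :=
  leftAct_of_le α (times_le _ _)

theorem rightAct_leftAct_eq (α : IdealIso P) (e : P) :
    α.rightAct (α.leftAct e) = α.cod ×ₚ e := by
  rw [← leftAct_cod_times, rightAct_leftAct α (times_le _ _)]

theorem leftAct_rightAct_eq (α : IdealIso P) (e : P) :
    α.leftAct (α.rightAct e) = e ⋆ₚ α.dom := by
  rw [← rightAct_star_dom, leftAct_rightAct α (star_le _ _)]

/-- Only `u` has to lie in the domain ideal: replacing `e` by `e ⋆ p` is harmless, because `(e ⋆ p)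
⋆ u = e ⋆ u` for `u ≤ p`. -/
theorem rightAct_star {α : IdealIso P} {u : P} (h : ProjLE u α.dom) (e : P) :
    α.rightAct e ⋆ₚ α.rightAct u = α.rightAct (e ⋆ₚ u) := by
  rw [rightAct_of_le α h, rightAct_of_le α (projLE_trans (star_le e u) h)]
  exact (congrArg Subtype.val (α.iso.map_star ⟨e ⋆ₚ α.dom, star_le _ _⟩ ⟨u, h⟩)).symm.trans
    (congrArg (fun x => (α.iso.toFun x).1) (Subtype.ext (star_star_of_le h e)))

theorem leftAct_times {α : IdealIso P} {u : P} (h : ProjLE u α.cod) (e : P) :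
    α.leftAct u ×ₚ α.leftAct e = α.leftAct (u ×ₚ e) := by
  rw [leftAct_of_le α h, leftAct_of_le α (projLE_trans (times_le u e) h)]
  exact (congrArg Subtype.val
    (α.iso.symm.map_times ⟨u, h⟩ ⟨α.cod ×ₚ e, times_le _ _⟩)).symm.trans
    (congrArg (fun x => (α.iso.symm.toFun x).1) (Subtype.ext (times_times_of_le h e)))

/-- Restricting `α` before applying it amounts to `⋆ (q × s)` afterwards, and `γ` then turns this
into `⋆ s`, which is how `β` truncates its argument. -/
theorem rightAct_mul (α β : IdealIso P) (e : P) :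
    (α * β).rightAct e = β.rightAct (α.rightAct e) := by
  have hw : ProjLE (α.leftAct β.dom) α.dom := leftAct_le _ _
  refine congrArg (fun x => (β.iso.toFun x).1) (Subtype.ext ?_)
  change (α.iso.toFun ⟨e ⋆ₚ α.leftAct β.dom, projLE_trans (star_le _ _) hw⟩).1
    ⋆ₚ (α.cod ⋆ₚ β.dom) = α.rightAct e ⋆ₚ β.dom
  rw [← rightAct_of_le, ← rightAct_star hw, rightAct_leftAct_eq,
    times_star_star_of_le (rightAct_le _ _)]

theorem leftAct_mul (α β : IdealIso P) (e : P) :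
    (α * β).leftAct e = α.leftAct (β.leftAct e) := by
  have hw : ProjLE (β.rightAct α.cod) β.cod := rightAct_le _ _
  refine congrArg (fun x => (α.iso.symm.toFun x).1) (Subtype.ext ?_)
  change (α.cod ×ₚ β.dom) ×ₚ
    (β.iso.symm.toFun ⟨β.rightAct α.cod ×ₚ e, projLE_trans (times_le _ _) hw⟩).1
    = α.cod ×ₚ β.leftAct e
  rw [← leftAct_of_le, ← leftAct_times hw, leftAct_rightAct_eq,
    times_times_star_of_le (leftAct_le _ _)]

/-- The identity isomorphism of `p^↓`, as an element of `M(P)`. -/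
def idOn (p : P) : IdealIso P := ⟨p, p, ProjIso.refl _⟩

theorem rightAct_idOn (p e : P) : (idOn p).rightAct e = e ⋆ₚ p := rfl

theorem leftAct_idOn (p e : P) : (idOn p).leftAct e = p ×ₚ e := rfl

theorem idOn_dom_mul (α : IdealIso P) : idOn α.dom * α = α := by
  refine ext_of_acts (fun e => ?_) fun e => ?_
  · rw [rightAct_mul, rightAct_idOn]
    exact congrArg (fun x => (α.iso.toFun x).1) (Subtype.ext (star_eq_of_le (star_le _ _)))
  · rw [leftAct_mul, leftAct_idOn, ← leftAct_le]

theorem mul_idOn_cod (α : IdealIso P) : α * idOn α.cod = α := by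
  refine ext_of_acts (fun e => ?_) fun e => ?_
  · rw [rightAct_mul, rightAct_idOn, star_eq_of_le (rightAct_le _ _)]
  · rw [leftAct_mul, leftAct_idOn]
    exact congrArg (fun x => (α.iso.symm.toFun x).1) (Subtype.ext (times_le _ _).symm)

theorem idOn_sandwich {u p : P} (h : ProjLE u p) : idOn p * idOn u * idOn p = idOn u := by
  refine ext_of_acts (fun e => ?_) fun e => ?_
  · simp only [rightAct_mul, rightAct_idOn]
    rw [star_star_of_le h, star_eq_of_le (projLE_trans (star_le _ _) h)]
  · simp only [leftAct_mul, leftAct_idOn]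
    rw [times_times_of_le h, ← projLE_trans (times_le _ _) h]

/-- Common source of both ample laws: take `u = β.cod ⋆ α.dom` for one and `u = α.leftAct β.dom` for
the other. -/
theorem mul_idOn_rightAct (α : IdealIso P) {u : P} (h : ProjLE u α.dom) :
    α * idOn (α.rightAct u) = idOn u * α := by
  refine ext_of_acts (fun e => ?_) fun e => ?_
  · rw [rightAct_mul, rightAct_mul, rightAct_idOn, rightAct_idOn, rightAct_star h]
  · rw [leftAct_mul, leftAct_mul, leftAct_idOn, leftAct_idOn, ← leftAct_times (rightAct_le _ _),
      leftAct_rightAct _ h]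

instance : IsDRCRestriction (IdealIso P) where
  mul_assoc α β γ := ext_of_acts (fun e => by simp only [rightAct_mul])
    (fun e => by simp only [leftAct_mul])
  plus_mul := idOn_dom_mul
  mul_ast := mul_idOn_cod
  -- The domain of `α • β` is `α.leftAct β.dom` by definition, so it sees `β` only through its
  -- domain.
  plus_mul_plus _ _ := rfl
  ast_ast_mul _ _ := rfl
  plus_sandwich α β := (idOn_sandwich (leftAct_le α β.dom)).symm
  ast_sandwich α β := (idOn_sandwich (rightAct_le β α.cod)).symm
  plus_plus _ := rfl
  ast_ast _ := rfl
  ast_plus _ := rfl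
  plus_ast _ := rfl
  ample_ast α β := by
    have h := mul_idOn_rightAct α (star_le β.cod α.dom)
    rw [rightAct_star_dom] at h
    exact h
  ample_plus α β := by
    have h := mul_idOn_rightAct α (leftAct_le α β.dom)
    rw [rightAct_leftAct_eq] at h
    exact h.symm

theorem idOn_mem {T : BiUnarySubalgebra (IdealIso P)} (hT : T.IsFull) (p : P) :
    idOn p ∈ T.carrier := hT ⟨idOn p, rfl⟩

theorem eq_of_idOn_eq {p q : P} (h : idOn p = idOn q) : p = q := congrArg IdealIso.dom h

/-- Every full (2,1,1)-subalgebra of `S(M(P))` is projection-fundamental. -/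
theorem isProjectionFundamental_of_isFull {T : BiUnarySubalgebra (IdealIso P)} (hT : T.IsFull) :
    IsProjectionFundamental T.carrier := by
  intro σ hσ hsep a b hab
  have hp := hsep _ ⟨a, rfl⟩ _ ⟨b, rfl⟩ (hσ.plus _ _ hab)
  have ast_sep : ∀ c d : T.carrier, σ c d → c.1.cod = d.1.cod := by
    intro c d hcd
    have h : ∀ x : T.carrier, BiUnary.ast x ∈ projections T.carrier := fun x =>
      ⟨BiUnary.ast x, rfl⟩
    exact eq_of_idOn_eq (congrArg Subtype.val (hsep _ (h c) _ (h d) (hσ.ast _ _ hcd)))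
  refine Subtype.ext (ext_of_dom_cod (eq_of_idOn_eq (congrArg Subtype.val hp))
    (ast_sep a b hab) fun e _ => ?_)
  -- By definition, the range of `idOn e * a` has top `a.rightAct e`. Fullness supplies `idOn e`.
  exact ast_sep _ _ (hσ.mul_left _ _ ⟨idOn e, idOn_mem hT e⟩ hab)

end Actions

end IdealIso

/-- Projection-fundamentality is invariant under isomorphism. -/
theorem BiUnaryIso.isProjectionFundamental {S T : Type*} [BiUnary S] [BiUnary T]
    (φ : BiUnaryIso S T) (h : IsProjectionFundamental T) : IsProjectionFundamental S := by
  intro σ hσ hsep a b hab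
  have hi : ∀ x, φ.toEquiv.symm (φ.toFun x) = x := φ.left_inv
  have hr : ∀ y, φ.toFun (φ.toEquiv.symm y) = y := φ.right_inv
  have hmul : ∀ x y, φ.toEquiv.symm (x * y) = φ.toEquiv.symm x * φ.toEquiv.symm y := fun x y => by
    rw [← hi (_ * _), φ.map_mul, hr, hr]
  have hplus : ∀ x, φ.toEquiv.symm (BiUnary.plus x) = BiUnary.plus (φ.toEquiv.symm x) :=
    fun x => by rw [← hi (BiUnary.plus _), φ.map_plus, hr]
  have hast : ∀ x, φ.toEquiv.symm (BiUnary.ast x) = BiUnary.ast (φ.toEquiv.symm x) :=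
    fun x => by rw [← hi (BiUnary.ast _), φ.map_ast, hr]
  refine φ.toEquiv.injective (h (σ.comap φ.toEquiv.symm) ⟨?_, ?_, ?_, ?_⟩ ?_ _ _ ?_)
  · intro x y z hxy
    simp only [Setoid.comap_rel, hmul] at hxy ⊢
    exact hσ.mul_right _ _ _ hxy
  · intro x y z hxy
    simp only [Setoid.comap_rel, hmul] at hxy ⊢
    exact hσ.mul_left _ _ _ hxy
  · intro x y hxy
    simp only [Setoid.comap_rel, hplus] at hxy ⊢
    exact hσ.plus _ _ hxy
  · intro x y hxy
    simp only [Setoid.comap_rel, hast] at hxy ⊢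
    exact hσ.ast _ _ hxy
  · rintro _ ⟨x, rfl⟩ _ ⟨y, rfl⟩ hxy
    simp only [Setoid.comap_rel, hplus] at hxy
    have := hsep _ ⟨_, rfl⟩ _ ⟨_, rfl⟩ hxy
    rw [← hplus, ← hplus] at this
    exact φ.toEquiv.symm.injective this
  · simpa [Setoid.comap_rel] using hab

/-! ### Actions of a DRC-restriction semigroup on its projections -/

namespace IsDRCRestriction

open BiUnary

variable {S : Type*} [BiUnary S] [IsDRCRestriction S]

/-- The projection `x⁺`. -/
def plusProj (x : S) : projections S := ⟨plus x, x, rfl⟩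

/-- The projection `x^∗`. -/
def astProj (x : S) : projections S := ⟨ast x, ast x, plus_ast x⟩

/-- The action `e ↦ (ex)^∗` of `x` on projections. -/
def rightAct (x : S) (e : projections S) : projections S := astProj (e.1 * x)

/-- The action `e ↦ (xe)⁺` of `x` on projections. -/
def leftAct (x : S) (e : projections S) : projections S := plusProj (x * e.1)

theorem rightAct_mul (x y : S) (e : projections S) :
    rightAct (x * y) e = rightAct y (rightAct x e) := Subtype.ext <| by
  change ast (e.1 * (x * y)) = ast (ast (e.1 * x) * y)
  rw [← ast_ast_mul, mul_assoc]

theorem leftAct_mul (x y : S) (e : projections S) :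
    leftAct (x * y) e = leftAct x (leftAct y e) := Subtype.ext <| by
  change plus ((x * y) * e.1) = plus (x * plus (y * e.1))
  rw [← plus_mul_plus, mul_assoc]

theorem rightAct_proj (e f : projections S) : rightAct f.1 e = e ⋆ₚ f := rfl

theorem leftAct_proj (e f : projections S) : leftAct f.1 e = f ×ₚ e := rfl

theorem rightAct_star_plusProj (x : S) (e : projections S) :
    rightAct x (e ⋆ₚ plusProj x) = rightAct x e := by
  rw [← rightAct_proj, ← rightAct_mul]
  exact congrArg (fun y => rightAct y e) (plus_mul x)

theorem leftAct_astProj_times (x : S) (e : projections S) :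
    leftAct x (astProj x ×ₚ e) = leftAct x e := by
  rw [← leftAct_proj, ← leftAct_mul]
  exact congrArg (fun y => leftAct y e) (mul_ast x)

/-- The ample law gives `x(ex)^∗ = (ex⁺)^∗x = ex`, and `(ex)⁺ = (ex⁺)⁺ = e`. The hypotheses are the
equations needed from `e ≤ x⁺`. -/
theorem leftAct_rightAct {x : S} {e : projections S} (h : e ⋆ₚ plusProj x = e)
    (k : e ×ₚ plusProj x = e) : leftAct x (rightAct x e) = e := by
  conv_rhs => rw [← k]
  refine Subtype.ext ?_
  have h1 : ast (e.1 * plus x) = e.1 := congrArg Subtype.val h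
  change plus (x * ast (e.1 * x)) = plus (e.1 * plus x)
  rw [ample_ast, h1, ← plus_mul_plus]

theorem rightAct_leftAct {x : S} {e : projections S} (h : astProj x ×ₚ e = e)
    (k : astProj x ⋆ₚ e = e) : rightAct x (leftAct x e) = e := by
  conv_rhs => rw [← k]
  refine Subtype.ext ?_
  have h1 : plus (ast x * e.1) = e.1 := congrArg Subtype.val h
  change ast (plus (x * e.1) * x) = ast (ast x * e.1)
  rw [ample_plus, h1, ← ast_ast_mul]

/-- Both sides are `(efx)^∗`, since the ample law gives `x(fx)^∗ = fx`. -/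
theorem rightAct_star {x : S} {f : projections S} (h : f ⋆ₚ plusProj x = f)
    (e : projections S) : rightAct x (e ⋆ₚ f) = rightAct x e ⋆ₚ rightAct x f := by
  refine Subtype.ext ?_
  have h1 : ast (f.1 * plus x) = f.1 := congrArg Subtype.val h
  change ast (ast (e.1 * f.1) * x) = ast (ast (e.1 * x) * ast (f.1 * x))
  rw [← ast_ast_mul, ← ast_ast_mul, mul_assoc, mul_assoc, ample_ast, h1]

theorem leftAct_times {x : S} {e : projections S} (h : astProj x ×ₚ e = e)
    (f : projections S) : leftAct x (e ×ₚ f) = leftAct x e ×ₚ leftAct x f := by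
  refine Subtype.ext ?_
  have h1 : plus (ast x * e.1) = e.1 := congrArg Subtype.val h
  change plus (x * plus (e.1 * f.1)) = plus (plus (x * e.1) * plus (x * f.1))
  rw [← plus_mul_plus, ← plus_mul_plus, ← mul_assoc, ← mul_assoc, ample_plus, h1]

variable {P : Type*} [StrongProjectionAlgebra P]

theorem map_rightAct_le (θ : ProjIso (projections S) P) (x : S) (e : projections S) :
    ProjLE (θ.toFun (rightAct x e)) (θ.toFun (astProj x)) := by
  have h1 : rightAct x e = rightAct (ast x) (rightAct x e) := by
    rw [← rightAct_mul, mul_ast]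
  have h2 : rightAct x e = rightAct x e ⋆ₚ astProj x := h1
  rw [h2, θ.map_star]
  exact star_le _ _

theorem map_leftAct_le (θ : ProjIso (projections S) P) (x : S) (e : projections S) :
    ProjLE (θ.toFun (leftAct x e)) (θ.toFun (plusProj x)) := by
  have h1 : leftAct x e = leftAct (plus x) (leftAct x e) := by
    rw [← leftAct_mul, plus_mul]
  have h2 : leftAct x e = plusProj x ×ₚ leftAct x e := h1
  rw [h2, θ.map_times]
  exact times_le _ _

end IsDRCRestriction

namespace ProjIso

variable {P Q : Type*} [ProjOps P] [ProjOps Q] (θ : ProjIso P Q)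

theorem symm_toFun (x : P) : θ.symm.toFun (θ.toFun x) = x := θ.left_inv x

theorem toFun_symm (y : Q) : θ.toFun (θ.symm.toFun y) = y := θ.right_inv y

/-- A bijection which preserves `⋆`, and whose inverse preserves `×`, is an isomorphism. -/
def ofInverse (f : P ≃ Q) (hf : ∀ x y, f (x ⋆ₚ y) = f x ⋆ₚ f y)
    (hg : ∀ x y, f.symm (x ×ₚ y) = f.symm x ×ₚ f.symm y) : ProjIso P Q where
  toEquiv := f
  map_times x y := f.symm.injective (by
    change f.symm (f _) = f.symm (f x ×ₚ f y)
    rw [hg, f.symm_apply_apply, f.symm_apply_apply, f.symm_apply_apply])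
  map_star := hf

end ProjIso

/-! ### The representation of `S` in `S(M(P))` -/

namespace IsDRCRestriction

open BiUnary

variable {S P : Type*} [BiUnary S] [IsDRCRestriction S] [StrongProjectionAlgebra P]

/-- Only the operations of `P(S)` are available, so the consequences of the order are proved in `P`
and pulled back along `θ`. -/
theorem symm_relations (θ : ProjIso (projections S) P) {e : P} {p : projections S}
    (h : ProjLE e (θ.toFun p)) :
    θ.symm.toFun e ⋆ₚ p = θ.symm.toFun e ∧ θ.symm.toFun e ×ₚ p = θ.symm.toFun e ∧
      p ⋆ₚ θ.symm.toFun e = θ.symm.toFun e ∧ p ×ₚ θ.symm.toFun e = θ.symm.toFun e := by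
  have hp := θ.symm_toFun p
  refine ⟨?_, ?_, ?_, ?_⟩
  · conv_lhs => rw [← hp, ← θ.symm.map_star, star_eq_of_le h]
  · conv_lhs => rw [← hp, ← θ.symm.map_times, times_eq_of_le h]
  · conv_lhs => rw [← hp, ← θ.symm.map_star, star_eq_of_ge h]
  · conv_lhs => rw [← hp, ← θ.symm.map_times, ← h]

/-- The isomorphism `(x⁺)^↓ → (x^∗)^↓`, `e ↦ (ex)^∗`, transported to `P` along an isomorphism
`P(S) → P`. -/
def toIdealIso (θ : ProjIso (projections S) P) (x : S) : IdealIso P where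
  dom := θ.toFun (plusProj x)
  cod := θ.toFun (astProj x)
  -- The right action is known to respect `⋆` and its inverse, the left action, to respect `×`;
  -- together these suffice.
  iso := ProjIso.ofInverse
    { toFun e := ⟨θ.toFun (rightAct x (θ.symm.toFun e.1)), map_rightAct_le θ x _⟩
      invFun e := ⟨θ.toFun (leftAct x (θ.symm.toFun e.1)), map_leftAct_le θ x _⟩
      left_inv e := Subtype.ext <| by
        obtain ⟨h1, h2, _, _⟩ := symm_relations θ e.2
        change θ.toFun (leftAct x (θ.symm.toFun (θ.toFun (rightAct x (θ.symm.toFun e.1))))) = e.1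
        rw [θ.symm_toFun, leftAct_rightAct h1 h2, θ.toFun_symm]
      right_inv e := Subtype.ext <| by
        obtain ⟨_, _, h1, h2⟩ := symm_relations θ e.2
        change θ.toFun (rightAct x (θ.symm.toFun (θ.toFun (leftAct x (θ.symm.toFun e.1))))) = e.1
        rw [θ.symm_toFun, rightAct_leftAct h2 h1, θ.toFun_symm] }
    (fun e f => Subtype.ext <| by
      change θ.toFun (rightAct x (θ.symm.toFun (e.1 ⋆ₚ f.1))) =
        θ.toFun (rightAct x (θ.symm.toFun e.1)) ⋆ₚ θ.toFun (rightAct x (θ.symm.toFun f.1))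
      rw [θ.symm.map_star, rightAct_star (symm_relations θ f.2).1, θ.map_star])
    (fun e f => Subtype.ext <| by
      change θ.toFun (leftAct x (θ.symm.toFun (e.1 ×ₚ f.1))) =
        θ.toFun (leftAct x (θ.symm.toFun e.1)) ×ₚ θ.toFun (leftAct x (θ.symm.toFun f.1))
      rw [θ.symm.map_times, leftAct_times (symm_relations θ e.2).2.2.2, θ.map_times])

/-- Truncating by `x⁺` changes nothing because `x⁺x = x`, so the extended map is the action of `x`
itself. -/
theorem rightAct_toIdealIso (θ : ProjIso (projections S) P) (x : S) (e : P) :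
    (toIdealIso θ x).rightAct e = θ.toFun (rightAct x (θ.symm.toFun e)) := by
  change θ.toFun (rightAct x (θ.symm.toFun (e ⋆ₚ θ.toFun (plusProj x)))) = _
  rw [θ.symm.map_star, θ.symm_toFun, rightAct_star_plusProj]

theorem leftAct_toIdealIso (θ : ProjIso (projections S) P) (x : S) (e : P) :
    (toIdealIso θ x).leftAct e = θ.toFun (leftAct x (θ.symm.toFun e)) := by
  change θ.toFun (leftAct x (θ.symm.toFun (θ.toFun (astProj x) ×ₚ e))) = _
  rw [θ.symm.map_times, θ.symm_toFun, leftAct_astProj_times]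

theorem toIdealIso_mul (θ : ProjIso (projections S) P) (x y : S) :
    toIdealIso θ (x * y) = toIdealIso θ x * toIdealIso θ y :=
  IdealIso.ext_of_acts
    (fun e => by
      simp only [IdealIso.rightAct_mul, rightAct_toIdealIso, θ.symm_toFun, rightAct_mul])
    (fun e => by
      simp only [IdealIso.leftAct_mul, leftAct_toIdealIso, θ.symm_toFun, leftAct_mul])

/-- Yields compatibility with `⁺` and `^∗`, fullness of the image, and separation of projections by
the kernel. -/
theorem toIdealIso_proj (θ : ProjIso (projections S) P) (p : projections S) :
    toIdealIso θ p.1 = IdealIso.idOn (θ.toFun p) :=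
  IdealIso.ext_of_acts
    (fun e => by
      rw [rightAct_toIdealIso, rightAct_proj, θ.map_star, θ.toFun_symm]
      rfl)
    (fun e => by
      rw [leftAct_toIdealIso, leftAct_proj, θ.map_times, θ.toFun_symm]
      rfl)

theorem toIdealIso_plus (θ : ProjIso (projections S) P) (x : S) :
    toIdealIso θ (plus x) = plus (toIdealIso θ x) := toIdealIso_proj θ (plusProj x)

theorem toIdealIso_ast (θ : ProjIso (projections S) P) (x : S) :
    toIdealIso θ (ast x) = ast (toIdealIso θ x) := toIdealIso_proj θ (astProj x)

/-- The kernel is a projection-separating (2,1,1)-congruence. -/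
theorem toIdealIso_injective (θ : ProjIso (projections S) P) (h : IsProjectionFundamental S) :
    Function.Injective (toIdealIso θ) := by
  intro a b hab
  refine h (Setoid.ker (toIdealIso θ)) ⟨?_, ?_, ?_, ?_⟩ ?_ a b hab
  · intro x y z hxy
    rw [Setoid.ker_def] at hxy ⊢
    rw [toIdealIso_mul, toIdealIso_mul, hxy]
  · intro x y z hxy
    rw [Setoid.ker_def] at hxy ⊢
    rw [toIdealIso_mul, toIdealIso_mul, hxy]
  · intro x y hxy
    rw [Setoid.ker_def] at hxy ⊢
    rw [toIdealIso_plus, toIdealIso_plus, hxy]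
  · intro x y hxy
    rw [Setoid.ker_def] at hxy ⊢
    rw [toIdealIso_ast, toIdealIso_ast, hxy]
  · intro p hp q hq hpq
    rw [Setoid.ker_def, toIdealIso_proj θ ⟨p, hp⟩, toIdealIso_proj θ ⟨q, hq⟩] at hpq
    exact congrArg Subtype.val (θ.toEquiv.injective (IdealIso.eq_of_idOn_eq hpq))

/-- The image of `S` in `S(M(P))`. -/
def rangeIdealIso (θ : ProjIso (projections S) P) : BiUnarySubalgebra (IdealIso P) where
  carrier := Set.range (toIdealIso θ)
  mul_mem := by
    rintro _ _ ⟨x, rfl⟩ ⟨y, rfl⟩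
    exact ⟨x * y, toIdealIso_mul θ x y⟩
  plus_mem := by
    rintro _ ⟨x, rfl⟩
    exact ⟨plus x, toIdealIso_plus θ x⟩
  ast_mem := by
    rintro _ ⟨x, rfl⟩
    exact ⟨ast x, toIdealIso_ast θ x⟩

theorem isFull_rangeIdealIso (θ : ProjIso (projections S) P) : (rangeIdealIso θ).IsFull := by
  rintro _ ⟨α, rfl⟩
  refine ⟨(θ.symm.toFun α.dom).1, ?_⟩
  rw [toIdealIso_proj, θ.toFun_symm]
  rfl

/-- A projection-fundamental semigroup is isomorphic to its image in `S(M(P))`. -/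
noncomputable def isoRange (θ : ProjIso (projections S) P) (h : IsProjectionFundamental S) :
    BiUnaryIso S (rangeIdealIso θ).carrier where
  toEquiv := Equiv.ofInjective _ (toIdealIso_injective θ h)
  map_mul x y := Subtype.ext (toIdealIso_mul θ x y)
  map_plus x := Subtype.ext (toIdealIso_plus θ x)
  map_ast x := Subtype.ext (toIdealIso_ast θ x)

end IsDRCRestriction

/-! ### The whole algebra as a full subalgebra, and the theorem -/

/-- An algebra as a subalgebra of itself. -/
def BiUnarySubalgebra.top (S : Type*) [BiUnary S] : BiUnarySubalgebra S where
  carrier := Set.univ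
  mul_mem _ _ := trivial
  plus_mem _ := trivial
  ast_mem _ := trivial

/-- The isomorphism of `S` with its greatest subalgebra. -/
def BiUnarySubalgebra.isoTop (S : Type*) [BiUnary S] :
    BiUnaryIso S (BiUnarySubalgebra.top S).carrier where
  toEquiv := (Equiv.Set.univ S).symm
  map_mul _ _ := rfl
  map_plus _ := rfl
  map_ast _ := rfl

theorem theorem8p9 {P : Type*} [StrongProjectionAlgebra P] :
    (∀ (S : Type*) [BiUnary S] [IsDRCRestriction S],
      Nonempty (ProjIso (projections S) P) →
        (IsProjectionFundamental S ↔
          ∃ T : BiUnarySubalgebra (IdealIso P),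
            T.IsFull ∧ Nonempty (BiUnaryIso S T.carrier))) ∧
    IsDRCRestriction (IdealIso P) ∧ IsProjectionFundamental (IdealIso P) := by
  refine ⟨?_, inferInstance, ?_⟩
  · rintro S _ _ ⟨θ⟩
    constructor
    · intro h
      exact ⟨IsDRCRestriction.rangeIdealIso θ, IsDRCRestriction.isFull_rangeIdealIso θ,
        ⟨IsDRCRestriction.isoRange θ h⟩⟩
    · rintro ⟨T, hT, ⟨φ⟩⟩
      exact φ.isProjectionFundamental (IdealIso.isProjectionFundamental_of_isFull hT)
  · exact (BiUnarySubalgebra.isoTop (IdealIso P)).isProjectionFundamental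
      (IdealIso.isProjectionFundamental_of_isFull fun _ _ => trivial)
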